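/- Let $\{X_t\}_{t\ge 0}$ be a self-similar Lévy process of stability index $\alpha\in(0,2)$ on a probability space $(\Omega,\mathcal F,\mathbb P)$: that is, $X_0=0$ almost surely, $X$ has stationary and independent increments, $X_{at}$ has the same law as $a^{1/\alpha}X_t$ for all $a>0$ and $t>0$, and $X_1$ is not almost surely constant. Let $\mathcal T$ be a positive integer, let $\mathrm{lcm}(\mathcal T)$ be the least common multiple of $1,\dots,\mathcal T$, and put $N_k:=k\,\mathrm{lcm}(\mathcal T)$ for $k\ge 1$. For $q\ge 0$, an integer $1\le\tau\le\mathcal T$ and a multiple $N\ge 1$ of $\mathrm{lcm}(\mathcal T)$, define the empirical moment $${}^qM^\tau_N:=\frac{1}{N/\tau}\sum_{n=0}^{N/\tau-1}\bigl|X_{\tau n+\tau}-X_{\tau n}\bigr|^q .$$ Fix any $q\ge\alpha$ and let $\{a_{N_k}\}_{k\ge 1}$ be a (not necessarily strictly) increasing sequence of positive real numbers. If $\sum_{k=1}^\infty (k\,a_{N_k})^{-\alpha/q}$ converges, then $$\mathbb P\Biggl[\bigcap_{\tau=1}^{\mathcal T}\Bigl\{\omega\in\Omega:\lim_{k\to\infty}\frac{{}^qM^\tau_{N_k}(\omega)}{a_{N_k}}=0\Bigr\}\Biggr]=1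 ;$$ if this series diverges, then $$\mathbb P\Biggl[\bigcap_{\tau=1}^{\mathcal T}\Bigl\{\omega\in\Omega:\limsup_{k\to\infty}\frac{{}^qM^\tau_{N_k}(\omega)}{a_{N_k}}=\infty\Bigr\}\Biggr]=1 .$$ -/

import Mathlib

open MeasureTheory ProbabilityTheory Filter Topology
open scoped NNReal

noncomputable section

/-- The increment `X_{t+s} - X_t` of the process `X` at time `t` and scale `s`. -/
def increment {Ω : Type*} (X : ℝ≥0 → Ω → ℝ) (t s : ℝ≥0) (ω : Ω) : ℝ :=
  X (t + s) ω - X t ω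

/-- Stationary increments: the law of `X_{t+s} - X_t` does not depend on `t`. -/
def HasStationaryIncrements {Ω : Type*} [MeasurableSpace Ω] (X : ℝ≥0 → Ω → ℝ)
    (P : Measure Ω) : Prop :=
  ∀ t s : ℝ≥0, IdentDistrib (increment X t s) (increment X 0 s) P P

/-- A real-valued Lévy process: a process starting at zero with stationary and independent
increments. -/
structure IsLevyProcess {Ω : Type*} [MeasurableSpace Ω] (X : ℝ≥0 → Ω → ℝ)
    (P : Measure Ω) : Prop where
  measurable : ∀ t, Measurable (X t)
  zero : ∀ᵐ ω ∂P, X 0 ω = 0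
  stationary : HasStationaryIncrements X P
  indep : HasIndepIncrements X P

/-- Self-similarity with scaling exponent `H > 0`: `X_{at}` has the law of `a ^ H * X_t` for all
`a > 0` and `t > 0`. -/
def IsSelfSimilar {Ω : Type*} [MeasurableSpace Ω] (X : ℝ≥0 → Ω → ℝ) (H : ℝ)
    (P : Measure Ω) : Prop :=
  0 < H ∧ ∀ a t : ℝ≥0, 0 < a → 0 < t →
    IdentDistrib (X (a * t)) (fun ω ↦ (a : ℝ) ^ H * X t ω) P P

/-- A self-similar Lévy process of stability index `α`: a Lévy process which is self-similar with
scaling exponent `1 / α` and is not deterministic. Non-degeneracy rules out the zero process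
and, for `α = 1`, pure drifts; it says that the scale parameter of the strictly `α`-stable
marginals is positive. -/
structure IsSelfSimilarLevyProcess {Ω : Type*} [MeasurableSpace Ω] (X : ℝ≥0 → Ω → ℝ) (α : ℝ)
    (P : Measure Ω) : Prop where
  levy : IsLevyProcess X P
  selfSimilar : IsSelfSimilar X (1 / α) P
  nondegenerate : ¬ ∃ c : ℝ, ∀ᵐ ω ∂P, X 1 ω = c

/-- The empirical moment of order `q`: the average of `|X_{τ n + τ} - X_{τ n}| ^ q` over the `N / τ`
consecutive non-overlapping windows of size `τ` (to be used when `τ` divides `N`). -/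
def empiricalMoment {Ω : Type*} (X : ℝ≥0 → Ω → ℝ) (q : ℝ) (τ N : ℕ) (ω : Ω) : ℝ :=
  (1 / ((N / τ : ℕ) : ℝ)) *
    ∑ n ∈ Finset.range (N / τ), |increment X ((τ * n : ℕ) : ℝ≥0) (τ : ℝ≥0) ω| ^ q

/-- The least common multiple of the integers `1, …, T`. -/
def lcmUpTo (T : ℕ) : ℕ := (Finset.Icc 1 T).lcm id

/-- The sample sizes `N_k = k * lcm(1, …, T)`. -/
def sampleSize (T k : ℕ) : ℕ := k * lcmUpTo T

end

/-! For fixed `τ` the windows are independent and `|X_{τn+τ} - X_{τn}|` has the law of `τ ^ (1/α) *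
|X_1|`. If `|X_1|` has tails of exact order `x ^ (-α)`, the summands `|X_{τn+τ} - X_{τn}| ^ q` are
i.i.d. with tails of exact order `x ^ (-β)`, where `β = α / q ≤ 1`, and the dichotomy is a
Borel–Cantelli statement about their sums.

Both tail bounds come from the identity in law of a sum of `n` unit increments with `n ^ (1/α) *
X_1`. Upper bound: Ottaviani's inequality makes it unlikely that any of the `n` increments is much
larger than `n ^ (1/α)`, and independence turns this into a bound `1 / n` for each one
(`exists_tail_le_of_stable`). Lower bound: if large increments were too rare, the truncated sum,
whose variance is small, would concentrate the law of `X_1` near a constant, against nondegeneracy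
(`exists_le_tail_of_stable`).

If the series converges, the sums are compared along dyadic `k` with truncated sums: the maximum is
handled by Borel–Cantelli, fluctuations by Chebyshev and the mean by Kronecker's lemma
(`ae_tendsto_sum_div_of_summable`). If it diverges, a single summand infinitely often exceeds any
multiple of the normalization, by the second Borel–Cantelli lemma
(`ae_frequently_lt_sum_div_of_not_summable`). -/

/-! ### Maximal inequality and upper tail of a stable law. -/

/-- **Ottaviani's maximal inequality.** -/
theorem ottaviani_inequality {Ω : Type*} [MeasurableSpace Ω] {P : Measure Ω}
    [IsProbabilityMeasure P] {Z : ℕ → Ω → ℝ} (hZm : ∀ i, Measurable (Z i)) (hZ : iIndepFun Z P)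
    {n : ℕ} {M ε : ℝ}
    (hM : ∀ k ≤ n, P.real {ω | M < |∑ i ∈ Finset.Ico k n, Z i ω|} ≤ ε) :
    (1 - ε) * P.real {ω | ∃ k ≤ n, 2 * M < |∑ i ∈ Finset.range k, Z i ω|} ≤
      P.real {ω | M < |∑ i ∈ Finset.range n, Z i ω|} := by
  set S : ℕ → Ω → ℝ := fun k ω ↦ ∑ i ∈ Finset.range k, Z i ω with hS
  set G : ℕ → Set Ω := fun k ↦ {ω | |∑ i ∈ Finset.Ico k n, Z i ω| ≤ M} with hG
  -- First passage of `|S|` above `2 * M` at time `k`. It depends on the `Z i` with `i < k` only,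
  -- while `G k` depends on the later ones.
  set E : ℕ → Set Ω := fun k ↦ {ω | 2 * M < |S k ω| ∧ ∀ j < k, |S j ω| ≤ 2 * M} with hE
  have hSm : ∀ k, Measurable (S k) := fun k ↦ Finset.measurable_fun_sum _ fun i _ ↦ hZm i
  have hGm : ∀ k, MeasurableSet (G k) := fun k ↦
    measurableSet_le (Finset.measurable_fun_sum _ fun i _ ↦ hZm i).abs measurable_const
  -- The σ-algebra is left free: the ambient one serves additivity, the one generated by the past
  -- serves independence.
  have hE' : ∀ (m : MeasurableSpace Ω) (k : ℕ), (∀ j ≤ k, Measurable[m] (S j)) →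
      MeasurableSet[m] (E k) := by
    intro m k h
    have h1 : MeasurableSet[m] {ω | 2 * M < |S k ω|} :=
      (h k le_rfl).abs measurableSet_Ioi
    have h2 : MeasurableSet[m] (⋂ j ∈ Finset.range k, {ω | |S j ω| ≤ 2 * M}) :=
      Finset.measurableSet_biInter _ fun j hj ↦
        (h j (Finset.mem_range.1 hj).le).abs measurableSet_Iic
    convert h1.inter h2 using 1
    ext ω
    simp [hE]
  have hEm : ∀ k, MeasurableSet (E k) := fun k ↦ hE' _ k fun j _ ↦ hSm j
  have hdisj : Pairwise fun i j ↦ Disjoint (E i) (E j) := by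
    have key : ∀ i j, i < j → Disjoint (E i) (E j) := fun i j hij ↦
      Set.disjoint_left.2 fun ω h1 h2 ↦ absurd h1.1 (not_lt.2 (h2.2 i hij))
    intro i j hij
    rcases lt_or_gt_of_ne hij with h | h
    · exact key i j h
    · exact (key j i h).symm
  have hunion : {ω | ∃ k ≤ n, 2 * M < |S k ω|} = ⋃ k ∈ Finset.range (n + 1), E k := by
    ext ω
    simp only [Set.mem_ofPred_eq, Set.mem_iUnion, Finset.mem_range, exists_prop]
    constructor
    · rintro ⟨k, hk, h⟩
      classical
      have hex : ∃ k, 2 * M < |S k ω| := ⟨k, h⟩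
      refine ⟨Nat.find hex, ?_, Nat.find_spec hex, fun j hj ↦ not_lt.1 (Nat.find_min hex hj)⟩
      have := Nat.find_min' hex h
      omega
    · rintro ⟨k, hk, h⟩
      exact ⟨k, by omega, h.1⟩
  have hindep : ∀ k, P.real (E k ∩ G k) = P.real (E k) * P.real (G k) := by
    intro k
    have hd : Disjoint ((Finset.range k : Finset ℕ) : Set ℕ) (Finset.Ico k n : Finset ℕ) := by
      rw [Finset.disjoint_coe, Finset.disjoint_left]
      intro i hi hi'
      simp at hi hi'
      omega
    have hI := indep_iSup_of_disjoint (fun i ↦ (hZm i).comap_le) hZ hd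
    have hmeas : ∀ (s : Finset ℕ) (i : ℕ), i ∈ s →
        Measurable[⨆ j ∈ (s : Set ℕ), MeasurableSpace.comap (Z j) inferInstance] (Z i) := by
      intro s i hi
      exact (comap_measurable (Z i)).mono
        (le_iSup₂_of_le (f := fun j (_ : j ∈ (s : Set ℕ)) ↦
          MeasurableSpace.comap (Z j) inferInstance) i hi le_rfl) le_rfl
    have hsumm : Measurable[⨆ j ∈ (Finset.Ico k n : Set ℕ),
        MeasurableSpace.comap (Z j) inferInstance] fun ω ↦ ∑ i ∈ Finset.Ico k n, Z i ω :=
      Finset.measurable_fun_sum _ fun i hi ↦ hmeas _ i hi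
    have := (Indep_iff _ _ P).1 hI (E k) (G k)
      (hE' _ k fun j hj ↦ Finset.measurable_fun_sum _ fun i hi ↦ hmeas _ i
        (Finset.mem_range.2 ((Finset.mem_range.1 hi).trans_le hj)))
      (hsumm (measurableSet_le measurable_id.abs measurable_const :
        MeasurableSet {y : ℝ | |y| ≤ M}))
    simp [Measure.real, this]
  have hGε : ∀ k ≤ n, 1 - ε ≤ P.real (G k) := by
    intro k hk
    have h1 : P.real (G k)ᶜ ≤ ε := by
      convert hM k hk using 2
      ext ω
      simp [hG]
    rw [probReal_compl_eq_one_sub (hGm k)] at h1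
    linarith
  have hsub : (⋃ k ∈ Finset.range (n + 1), E k ∩ G k) ⊆ {ω | M < |S n ω|} := by
    intro ω hω
    simp only [Set.mem_iUnion, Finset.mem_range, exists_prop] at hω
    obtain ⟨k, hk, h1, h2⟩ := hω
    have h3 : S n ω = S k ω + ∑ i ∈ Finset.Ico k n, Z i ω :=
      (Finset.sum_range_add_sum_Ico _ (by omega)).symm
    have h4 : |S k ω| ≤ |S n ω| + |∑ i ∈ Finset.Ico k n, Z i ω| := by
      have : S k ω = S n ω - ∑ i ∈ Finset.Ico k n, Z i ω := by rw [h3]; ring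
      rw [this]
      exact abs_sub _ _
    have h5 := h1.1
    have h6 : |∑ i ∈ Finset.Ico k n, Z i ω| ≤ M := h2
    show M < |S n ω|
    linarith
  calc (1 - ε) * P.real {ω | ∃ k ≤ n, 2 * M < |S k ω|}
      = ∑ k ∈ Finset.range (n + 1), (1 - ε) * P.real (E k) := by
        rw [hunion, measureReal_biUnion_finset (fun i _ j _ h ↦ hdisj h) (fun k _ ↦ hEm k),
          Finset.mul_sum]
    _ ≤ ∑ k ∈ Finset.range (n + 1), P.real (E k ∩ G k) := by
        refine Finset.sum_le_sum fun k hk ↦ ?_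
        rw [hindep, mul_comm]
        exact mul_le_mul_of_nonneg_left (hGε k (Nat.lt_succ_iff.1 (Finset.mem_range.1 hk)))
          measureReal_nonneg
    _ = P.real (⋃ k ∈ Finset.range (n + 1), E k ∩ G k) :=
        (measureReal_biUnion_finset
          (fun i _ j _ h ↦ (hdisj h).mono Set.inter_subset_left Set.inter_subset_left)
          (fun k _ ↦ (hEm k).inter (hGm k))).symm
    _ ≤ P.real {ω | M < |S n ω|} := measureReal_mono hsub

theorem exists_measureReal_lt_abs_le {Ω : Type*} [MeasurableSpace Ω] {P : Measure Ω}
    [IsProbabilityMeasure P] {Y : Ω → ℝ} (hY : Measurable Y) {ε : ℝ} (hε : 0 < ε) :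
    ∃ M : ℝ, 0 < M ∧ P.real {ω | M < |Y ω|} ≤ ε := by
  have h : Tendsto (fun n : ℕ ↦ P.real {ω | (n : ℝ) < |Y ω|}) atTop (𝓝 0) := by
    have h1 := tendsto_measure_iInter_atTop (μ := P) (s := fun n : ℕ ↦ {ω | (n : ℝ) < |Y ω|})
      (fun n ↦ (measurableSet_lt measurable_const hY.abs).nullMeasurableSet)
      (fun m n hmn ω hω ↦ lt_of_le_of_lt (Nat.cast_le.2 hmn : (m : ℝ) ≤ n) hω) ⟨0, measure_ne_top _ _⟩
    have h2 : (⋂ n : ℕ, {ω | (n : ℝ) < |Y ω|}) = ∅ := by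
      ext ω
      simp only [Set.mem_iInter, Set.mem_ofPred_eq, Set.mem_empty_iff_false, iff_false, not_forall,
        not_lt]
      exact exists_nat_ge _
    rw [h2, measure_empty] at h1
    exact (ENNReal.tendsto_toReal ENNReal.zero_ne_top).comp h1
  obtain ⟨n, hn, hn'⟩ := ((h.eventually_le_const hε).and (eventually_ge_atTop 1)).exists
  exact ⟨n, by exact_mod_cast hn', hn⟩

/-- Partial sums that scale like those of a stable law force a polynomial upper tail bound. -/
theorem exists_tail_le_of_stable {Ω : Type*} [MeasurableSpace Ω] {P : Measure Ω}
    [IsProbabilityMeasure P] {Z : ℕ → Ω → ℝ} {Y : Ω → ℝ} {α : ℝ} (hα : 0 < α)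
    (hZm : ∀ i, Measurable (Z i)) (hYm : Measurable Y) (hZ : iIndepFun Z P)
    (hid : ∀ i, IdentDistrib (Z i) Y P P)
    (hsum : ∀ k n, k < n → IdentDistrib (fun ω ↦ ∑ i ∈ Finset.Ico k n, Z i ω)
      (fun ω ↦ ((n - k : ℕ) : ℝ) ^ (1 / α) * Y ω) P P) :
    ∃ C : ℝ, 0 < C ∧ ∀ x : ℝ, 0 < x → P.real {ω | x < |Y ω|} ≤ C * x ^ (-α) := by
  -- With `ε = 1 / 3` Ottaviani yields `P(A) ≤ (1/3) / (2/3) = 1/2` below.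
  obtain ⟨M, hM0, hM⟩ := exists_measureReal_lt_abs_le (P := P) hYm (ε := 1 / 3) (by norm_num)
  have key : ∀ n : ℕ, 0 < n →
      P.real {ω | 4 * (M * (n : ℝ) ^ (1 / α)) < |Y ω|} ≤ 1 / n := by
    intro n hn
    have hn' : (0 : ℝ) < n := by exact_mod_cast hn
    set s : ℝ := (n : ℝ) ^ (1 / α) with hs
    have hs0 : 0 < s := Real.rpow_pos_of_pos hn' _
    have htail : ∀ k ≤ n, P.real {ω | M * s < |∑ i ∈ Finset.Ico k n, Z i ω|} ≤ 1 / 3 := by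
      intro k hk
      rcases hk.eq_or_lt with rfl | hk
      · have : {ω : Ω | M * s < |∑ i ∈ Finset.Ico k k, Z i ω|} = ∅ := by
          ext ω
          simp
          positivity
        rw [this]
        simp
      · have h1 := (hsum k n hk).measure_mem_eq (s := {y | M * s < |y|})
          (measurableSet_lt measurable_const measurable_id.abs)
        have h2 : P.real {ω | M * s < |∑ i ∈ Finset.Ico k n, Z i ω|} =
            P.real {ω | M * s < |((n - k : ℕ) : ℝ) ^ (1 / α) * Y ω|} := by
          simp only [Measure.real]
          exact congrArg _ h1
        rw [h2]
        refine (measureReal_mono fun ω hω ↦ ?_).trans hM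
        have hω : M * s < |((n - k : ℕ) : ℝ) ^ (1 / α) * Y ω| := hω
        rw [abs_mul, abs_of_nonneg (by positivity)] at hω
        have h3 : ((n - k : ℕ) : ℝ) ^ (1 / α) ≤ s :=
          Real.rpow_le_rpow (by positivity) (by exact_mod_cast Nat.sub_le _ _) (by positivity)
        have h4 : ((n - k : ℕ) : ℝ) ^ (1 / α) * |Y ω| ≤ s * |Y ω| :=
          mul_le_mul_of_nonneg_right h3 (abs_nonneg _)
        show M < |Y ω|
        by_contra hcon
        have := mul_le_mul_of_nonneg_left (not_lt.1 hcon) hs0.le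
        linarith
    have hott := ottaviani_inequality hZm hZ htail
    have h0 := htail 0 (Nat.zero_le _)
    rw [← Finset.range_eq_Ico] at h0
    set A : Set Ω := {ω | ∃ k ≤ n, 2 * (M * s) < |∑ i ∈ Finset.range k, Z i ω|} with hA
    have hAle : P.real A ≤ 1 / 2 := by linarith
    set p := P.real {ω | 4 * (M * s) < |Y ω|} with hp
    set D : ℕ → Set Ω := fun i ↦ Z i ⁻¹' {y | |y| ≤ 4 * (M * s)} with hD
    have hDm : MeasurableSet {y : ℝ | |y| ≤ 4 * (M * s)} :=
      measurableSet_le measurable_id.abs measurable_const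
    have hDp : ∀ i, P (D i) = ENNReal.ofReal (1 - p) := by
      intro i
      rw [hD, (hid i).measure_mem_eq hDm, ← ofReal_measureReal, hp,
        ← probReal_compl_eq_one_sub (measurableSet_lt measurable_const hYm.abs)]
      congr 2
      ext ω
      simp
    have hp1 : p ≤ 1 := measureReal_le_one
    have hprod : P.real (⋂ i ∈ Finset.range n, D i) = (1 - p) ^ n := by
      rw [Measure.real, hZ.measure_inter_preimage_eq_mul (Finset.range n)
        (sets := fun _ ↦ {y | |y| ≤ 4 * (M * s)}) (fun _ _ ↦ hDm)]
      rw [Finset.prod_congr rfl fun i _ ↦ hDp i]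
      simp [ENNReal.toReal_ofReal (sub_nonneg.2 hp1)]
    -- A summand above `4 * (M * s)` is a difference of two consecutive partial sums, one of which
    -- must exceed `2 * (M * s)`.
    have hcov : (⋂ i ∈ Finset.range n, D i)ᶜ ⊆ A := by
      intro ω hω
      simp only [Set.mem_compl_iff, Set.mem_iInter, Finset.mem_range, not_forall] at hω
      obtain ⟨i, hi, h⟩ := hω
      have h : 4 * (M * s) < |Z i ω| := not_le.1 h
      by_contra hcon
      simp only [hA, Set.mem_ofPred_eq, not_exists, not_and, not_lt] at hcon
      have h1 := hcon i hi.le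
      have h2 := hcon (i + 1) hi
      rw [Finset.sum_range_succ] at h2
      have h3 := abs_sub (∑ j ∈ Finset.range i, Z j ω + Z i ω) (∑ j ∈ Finset.range i, Z j ω)
      rw [add_sub_cancel_left] at h3
      linarith
    have hmeas : MeasurableSet (⋂ i ∈ Finset.range n, D i) :=
      Finset.measurableSet_biInter _ fun i _ ↦ hZm i hDm
    have h4 := measureReal_mono (μ := P) hcov
    rw [probReal_compl_eq_one_sub hmeas, hprod] at h4
    have h5 : (1 - p) ^ n ≤ Real.exp (-(n * p)) := by
      have := pow_le_pow_left₀ (sub_nonneg.2 hp1) (Real.one_sub_le_exp_neg p) n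
      rwa [← Real.exp_nat_mul, mul_neg] at this
    have h6 : Real.exp (n * p) ≤ 2 := by
      have h7 : Real.exp (-(n * p)) * Real.exp (n * p) = 1 := by
        rw [← Real.exp_add]; simp
      have h8 := Real.exp_pos (n * p)
      nlinarith
    have h9 := Real.add_one_le_exp (n * p)
    rw [le_div_iff₀ hn']
    linarith
  -- Below `4 * M` this bound exceeds one. Above, `key` is used at `n = ⌊y⌋₊` with `y = (x / (4 *
  -- M)) ^ α`; the factor 2 pays for `y ≤ 2 * ⌊y⌋₊`.
  refine ⟨2 * (4 * M) ^ α, by positivity, fun x hx ↦ ?_⟩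
  have hx' : 2 * (4 * M) ^ α * x ^ (-α) = 2 / (x / (4 * M)) ^ α := by
    rw [Real.div_rpow hx.le (by positivity), Real.rpow_neg hx.le]
    have := Real.rpow_pos_of_pos hx α
    field_simp
  rw [hx']
  rcases lt_or_ge x (4 * M) with hlt | hge
  · have h1 : (x / (4 * M)) ^ α ≤ 1 :=
      Real.rpow_le_one (by positivity) ((div_le_one (by positivity)).2 hlt.le) hα.le
    have h2 : 0 < (x / (4 * M)) ^ α := by positivity
    have h3 : (1 : ℝ) ≤ 2 / (x / (4 * M)) ^ α := by
      rw [le_div_iff₀ h2]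
      linarith
    exact measureReal_le_one.trans h3
  · set y := (x / (4 * M)) ^ α with hy
    have hy1 : 1 ≤ y := Real.one_le_rpow ((one_le_div (by positivity)).2 hge) hα.le
    have hn : 0 < ⌊y⌋₊ := Nat.floor_pos.2 hy1
    have hn' : (0 : ℝ) < ⌊y⌋₊ := by exact_mod_cast hn
    have h1 : (⌊y⌋₊ : ℝ) ^ (1 / α) ≤ x / (4 * M) := by
      have := Real.rpow_le_rpow (by positivity) (Nat.floor_le (zero_le_one.trans hy1))
        (one_div_nonneg.2 hα.le)
      rwa [hy, ← Real.rpow_mul (by positivity), mul_one_div_cancel hα.ne', Real.rpow_one] at this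
    have h2 : 4 * (M * (⌊y⌋₊ : ℝ) ^ (1 / α)) ≤ x := by
      rw [le_div_iff₀ (by positivity)] at h1
      linarith
    refine (measureReal_mono fun ω hω ↦ lt_of_le_of_lt h2 hω).trans ((key _ hn).trans ?_)
    rw [div_le_div_iff₀ hn' (by linarith)]
    have h3 := Nat.lt_floor_add_one y
    have h4 : (1 : ℝ) ≤ ⌊y⌋₊ := by exact_mod_cast hn
    linarith

/-! ### Truncation and lower tail of a stable law. -/

/-- The truncation of a real number at level `R`. -/
noncomputable def truncate (R y : ℝ) : ℝ := if |y| ≤ R then y else 0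

theorem measurable_truncate (R : ℝ) : Measurable (truncate R) :=
  Measurable.ite (measurableSet_le measurable_id.abs measurable_const) measurable_id
    measurable_const

theorem abs_truncate_le {R : ℝ} (hR : 0 ≤ R) (y : ℝ) : |truncate R y| ≤ R := by
  unfold truncate
  split_ifs with h
  · exact h
  · simpa

theorem abs_truncate_le_abs (R y : ℝ) : |truncate R y| ≤ |y| := by
  unfold truncate
  split_ifs <;> simp

theorem memLp_truncate {Ω : Type*} [MeasurableSpace Ω] {P : Measure Ω} [IsFiniteMeasure P]
    {Y : Ω → ℝ} (hY : Measurable Y) {R : ℝ} (hR : 0 ≤ R) (p : ENNReal) :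
    MemLp (fun ω ↦ truncate R (Y ω)) p P :=
  MemLp.of_bound ((measurable_truncate R).comp hY).aestronglyMeasurable R
    (Eventually.of_forall fun _ ↦ abs_truncate_le hR _)

/-- Layer-cake formula: the tail bound is integrated against `2 * t` over `(0, R]`, and `β < 2`
makes this integrable at zero. -/
theorem integral_truncate_sq_le {Ω : Type*} [MeasurableSpace Ω] {P : Measure Ω}
    [IsProbabilityMeasure P] {Y : Ω → ℝ} (hY : Measurable Y) {C β : ℝ} (hC : 0 ≤ C) (hβ : β < 2)
    (htail : ∀ x : ℝ, 0 < x → P.real {ω | x < |Y ω|} ≤ C * x ^ (-β)) {R : ℝ} (hR : 0 < R) :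
    ∫ ω, truncate R (Y ω) ^ 2 ∂P ≤ 2 * C / (2 - β) * R ^ (2 - β) := by
  have hm : Measurable fun ω ↦ truncate R (Y ω) := (measurable_truncate R).comp hY
  have hint : ∫ t in (0 : ℝ)..R, 2 * C * t ^ (1 - β) = 2 * C / (2 - β) * R ^ (2 - β) := by
    rw [intervalIntegral.integral_const_mul, integral_rpow (Or.inl (by linarith)),
      show 1 - β + 1 = 2 - β by ring, Real.zero_rpow (by linarith)]
    ring
  have hii : IntegrableOn (fun t : ℝ ↦ 2 * C * t ^ (1 - β)) (Set.Ioc 0 R) := by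
    have := (intervalIntegral.intervalIntegrable_rpow' (a := 0) (b := R) (r := 1 - β)
      (by linarith)).const_mul (2 * C)
    rwa [intervalIntegrable_iff_integrableOn_Ioc_of_le hR.le] at this
  have hlay := lintegral_comp_eq_lintegral_meas_lt_mul P (f := fun ω ↦ |truncate R (Y ω)|)
    (g := fun t ↦ 2 * t) (Eventually.of_forall fun ω ↦ abs_nonneg _) hm.abs.aemeasurable
    (fun t _ ↦ Continuous.intervalIntegrable (by fun_prop) _ _)
    ((ae_restrict_mem measurableSet_Ioi).mono fun t ht ↦ by
      have : 0 < t := ht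
      positivity)
  have hsq : ∀ ω, ∫ t in (0 : ℝ)..|truncate R (Y ω)|, 2 * t = truncate R (Y ω) ^ 2 := by
    intro ω
    rw [intervalIntegral.integral_const_mul, integral_id, sq_abs]
    ring
  simp only [hsq] at hlay
  have hle : ∫⁻ t in Set.Ioi 0, P {ω | t < |truncate R (Y ω)|} * ENNReal.ofReal (2 * t) ≤
      ∫⁻ t in Set.Ioc 0 R, ENNReal.ofReal (2 * C * t ^ (1 - β)) := by
    rw [← lintegral_indicator measurableSet_Ioi, ← lintegral_indicator measurableSet_Ioc]
    refine lintegral_mono fun t ↦ ?_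
    by_cases ht : 0 < t
    · rw [Set.indicator_of_mem (show t ∈ Set.Ioi 0 from ht)]
      by_cases htR : t ≤ R
      · rw [Set.indicator_of_mem (show t ∈ Set.Ioc 0 R from ⟨ht, htR⟩)]
        have h1 : P {ω | t < |truncate R (Y ω)|} ≤ ENNReal.ofReal (C * t ^ (-β)) := by
          rw [← ofReal_measureReal]
          refine ENNReal.ofReal_le_ofReal ((measureReal_mono fun ω hω ↦ ?_).trans (htail t ht))
          exact lt_of_lt_of_le hω (abs_truncate_le_abs _ _)
        refine (mul_le_mul_left h1 _).trans ?_
        rw [← ENNReal.ofReal_mul (by positivity)]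
        refine ENNReal.ofReal_le_ofReal (le_of_eq ?_)
        rw [show 1 - β = -β + 1 by ring, Real.rpow_add_one ht.ne']
        ring
      · have : {ω | t < |truncate R (Y ω)|} = ∅ := by
          ext ω
          have := abs_truncate_le hR.le (Y ω)
          simp only [Set.mem_ofPred_eq, Set.mem_empty_iff_false, iff_false, not_lt]
          linarith
        simp [this]
    · rw [Set.indicator_of_notMem (show t ∉ Set.Ioi 0 from ht)]
      exact zero_le
  rw [integral_eq_lintegral_of_nonneg_ae (Eventually.of_forall fun ω ↦ sq_nonneg _)
    (hm.pow_const 2).aestronglyMeasurable, hlay]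
  rw [← ofReal_integral_eq_lintegral_ofReal hii, ← intervalIntegral.integral_of_le hR.le,
    hint] at hle
  · have hnn : 0 ≤ 2 * C / (2 - β) * R ^ (2 - β) := by
      have : 0 < 2 - β := by linarith
      positivity
    exact ENNReal.toReal_le_of_le_ofReal hnn hle
  · refine (ae_restrict_mem measurableSet_Ioc).mono fun t ht ↦ ?_
    have : 0 < t := ht.1
    show 0 ≤ 2 * C * t ^ (1 - β)
    positivity

theorem variance_sum_truncate_le {Ω : Type*} [MeasurableSpace Ω] {P : Measure Ω}
    [IsProbabilityMeasure P] {Z : ℕ → Ω → ℝ} {Y : Ω → ℝ} (hZm : ∀ i, Measurable (Z i))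
    (hY : Measurable Y) (hZ : iIndepFun Z P) (hid : ∀ i, IdentDistrib (Z i) Y P P)
    {C β : ℝ} (hC : 0 ≤ C) (hβ : β < 2)
    (htail : ∀ x : ℝ, 0 < x → P.real {ω | x < |Y ω|} ≤ C * x ^ (-β)) {R : ℝ} (hR : 0 < R) (n : ℕ) :
    variance (fun ω ↦ ∑ i ∈ Finset.range n, truncate R (Z i ω)) P ≤
      n * (2 * C / (2 - β) * R ^ (2 - β)) := by
  have h1 := IndepFun.variance_sum (μ := P) (X := fun i ω ↦ truncate R (Z i ω))
    (s := Finset.range n) (fun i _ ↦ memLp_truncate (hZm i) hR.le 2)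
    (fun i _ j _ hij ↦ (hZ.indepFun hij).comp (measurable_truncate R) (measurable_truncate R))
  have h2 : (fun ω ↦ ∑ i ∈ Finset.range n, truncate R (Z i ω)) =
      ∑ i ∈ Finset.range n, fun ω ↦ truncate R (Z i ω) := by
    ext ω
    simp
  rw [h2, h1]
  refine (Finset.sum_le_card_nsmul _ _ (2 * C / (2 - β) * R ^ (2 - β)) fun i _ ↦ ?_).trans_eq ?_
  · refine ((hid i).comp (measurable_truncate R)).variance_eq.trans_le ?_
    exact (variance_le_expectation_sq ((measurable_truncate R).comp hY).aestronglyMeasurable).trans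
      (integral_truncate_sq_le hY hC hβ htail hR)
  · simp

/-- By Borel–Cantelli with `ε = 2 ^ (-m)`, the deterministic centres converge to `Y ω` for almost
every `ω`, and a sequence has only one limit. -/
theorem exists_ae_eq_const_of_concentrated {Ω : Type*} [MeasurableSpace Ω] {P : Measure Ω}
    [IsProbabilityMeasure P] {Y : Ω → ℝ}
    (h : ∀ ε : ℝ, 0 < ε → ∃ c : ℝ, P.real {ω | ε < |Y ω - c|} ≤ ε) :
    ∃ c : ℝ, ∀ᵐ ω ∂P, Y ω = c := by
  choose! c hc using h
  set u : ℕ → ℝ := fun m ↦ (1 / 2) ^ m with hu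
  have hu0 : ∀ m, 0 < u m := fun m ↦ by positivity
  have hsum : ∑' m, P {ω | u m < |Y ω - c (u m)|} ≠ ⊤ := by
    have h1 : ∀ m, P {ω | u m < |Y ω - c (u m)|} ≤ ENNReal.ofReal (u m) := fun m ↦ by
      rw [← ofReal_measureReal]
      exact ENNReal.ofReal_le_ofReal (hc _ (hu0 m))
    refine ne_top_of_le_ne_top ?_ (ENNReal.tsum_le_tsum h1)
    exact summable_geometric_two.tsum_ofReal_ne_top
  have hlim : ∀ᵐ ω ∂P, Tendsto (fun m ↦ c (u m)) atTop (𝓝 (Y ω)) := by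
    filter_upwards [ae_eventually_notMem hsum] with ω hω
    rw [tendsto_iff_dist_tendsto_zero]
    refine squeeze_zero' (Eventually.of_forall fun _ ↦ dist_nonneg) (hω.mono fun m hm ↦ ?_)
      (tendsto_pow_atTop_nhds_zero_of_lt_one (r := (1 / 2 : ℝ)) (by norm_num) (by norm_num))
    rw [dist_comm, Real.dist_eq]
    exact not_lt.1 hm
  obtain ⟨ω₀, h₀⟩ := hlim.exists
  exact ⟨Y ω₀, hlim.mono fun ω hω ↦ tendsto_nhds_unique hω h₀⟩

/-- A nondegenerate stable law of index `α < 2` has a polynomial lower tail bound. -/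
theorem exists_le_tail_of_stable {Ω : Type*} [MeasurableSpace Ω] {P : Measure Ω}
    [IsProbabilityMeasure P] {Z : ℕ → Ω → ℝ} {Y : Ω → ℝ} {α C : ℝ} (hα : 0 < α) (hα2 : α < 2)
    (hZm : ∀ i, Measurable (Z i)) (hYm : Measurable Y) (hZ : iIndepFun Z P)
    (hid : ∀ i, IdentDistrib (Z i) Y P P)
    (hsum : ∀ n : ℕ, 0 < n → IdentDistrib (fun ω ↦ ∑ i ∈ Finset.range n, Z i ω)
      (fun ω ↦ (n : ℝ) ^ (1 / α) * Y ω) P P)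
    (hC : 0 < C) (htail : ∀ x : ℝ, 0 < x → P.real {ω | x < |Y ω|} ≤ C * x ^ (-α))
    (hY : ¬ ∃ c : ℝ, ∀ᵐ ω ∂P, Y ω = c) :
    ∃ c : ℝ, 0 < c ∧ ∀ r : ℝ, 1 ≤ r → c * r ^ (-α) ≤ P.real {ω | r < |Y ω|} := by
  obtain ⟨ε, hε, hconc⟩ : ∃ ε : ℝ, 0 < ε ∧ ∀ c : ℝ, ε < P.real {ω | ε < |Y ω - c|} := by
    by_contra hcon
    push Not at hcon
    exact hY (exists_ae_eq_const_of_concentrated hcon)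
  have h2α : 0 < 2 - α := by linarith
  set K : ℝ := 2 * C / (2 - α) with hK
  have hK0 : 0 < K := by positivity
  -- The truncation level `x * n ^ (1/α)` is tuned so that Chebyshev costs at most `ε / 2`, half of
  -- the spread guaranteed by `hconc`.
  obtain ⟨x, hx0, hx⟩ : ∃ x : ℝ, 0 < x ∧ K * x ^ (2 - α) / ε ^ 2 = ε / 2 := by
    refine ⟨(ε ^ 3 / (2 * K)) ^ (1 / (2 - α)), by positivity, ?_⟩
    rw [← Real.rpow_mul (by positivity), one_div_mul_cancel h2α.ne', Real.rpow_one]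
    field_simp
  have key : ∀ n : ℕ, 0 < n → ε / 2 ≤ n * P.real {ω | x * (n : ℝ) ^ (1 / α) < |Y ω|} := by
    intro n hn
    have hn' : (0 : ℝ) < n := by exact_mod_cast hn
    set s : ℝ := (n : ℝ) ^ (1 / α) with hs
    have hs0 : 0 < s := Real.rpow_pos_of_pos hn' _
    have hsα : s ^ α = n := by
      rw [hs, ← Real.rpow_mul hn'.le, one_div_mul_cancel hα.ne', Real.rpow_one]
    set R := x * s with hR
    have hR0 : 0 < R := by positivity
    set U : Ω → ℝ := fun ω ↦ ∑ i ∈ Finset.range n, truncate R (Z i ω) with hU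
    set m := ∫ ω, U ω ∂P with hm
    have h1 : P.real {ω | ε * s < |∑ i ∈ Finset.range n, Z i ω - m|} =
        P.real {ω | ε < |Y ω - m / s|} := by
      have h := (hsum n hn).measure_mem_eq (s := {y | ε * s < |y - m|})
        (measurableSet_lt measurable_const (measurable_id.sub_const m).abs)
      have h' : {ω | ε < |Y ω - m / s|} =
          (fun ω ↦ (n : ℝ) ^ (1 / α) * Y ω) ⁻¹' {y | ε * s < |y - m|} := by
        ext ω
        have : s * Y ω - m = s * (Y ω - m / s) := by field_simp
        simp only [Set.mem_ofPred_eq, Set.mem_preimage]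
        rw [← hs, this, abs_mul, abs_of_pos hs0, mul_comm s, mul_lt_mul_iff_left₀ hs0]
      rw [h']
      simp only [Measure.real]
      exact congrArg _ h
    -- Without a summand above `R`, the sum equals its truncated version.
    have h2 : {ω | ε * s < |∑ i ∈ Finset.range n, Z i ω - m|} ⊆
        (⋃ i ∈ Finset.range n, {ω | R < |Z i ω|}) ∪ {ω | ε * s ≤ |U ω - m|} := by
      intro ω hω
      by_cases hbig : ∃ i ∈ Finset.range n, R < |Z i ω|
      · left
        simpa using hbig
      · right
        push Not at hbig
        have : U ω = ∑ i ∈ Finset.range n, Z i ω :=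
          Finset.sum_congr rfl fun i hi ↦ if_pos (hbig i hi)
        show ε * s ≤ |U ω - m|
        rw [this]
        exact le_of_lt hω
    have h3 : P.real (⋃ i ∈ Finset.range n, {ω | R < |Z i ω|}) ≤ n * P.real {ω | R < |Y ω|} := by
      refine (measureReal_biUnion_finset_le _ _).trans ?_
      have : ∀ i ∈ Finset.range n, P.real {ω | R < |Z i ω|} = P.real {ω | R < |Y ω|} := by
        intro i _
        have h := (hid i).measure_mem_eq (s := {y | R < |y|})
          (measurableSet_lt measurable_const measurable_id.abs)
        simp only [Measure.real]
        exact congrArg _ h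
      rw [Finset.sum_congr rfl this]
      simp
    have h4 : P.real {ω | ε * s ≤ |U ω - m|} ≤ ε / 2 := by
      have hUL : MemLp U 2 P := memLp_finsetSum _ fun i _ ↦ memLp_truncate (hZm i) hR0.le 2
      have h := meas_ge_le_variance_div_sq hUL (c := ε * s) (by positivity)
      have hv := variance_sum_truncate_le hZm hYm hZ hid hC.le hα2 htail hR0 n
      have h5 : variance U P / (ε * s) ^ 2 ≤ ε / 2 := by
        rw [← hx]
        -- Since `s ^ α = n`, all dependence on `n` cancels.
        have h6 : (n : ℝ) * (K * R ^ (2 - α)) / (ε * s) ^ 2 = K * x ^ (2 - α) / ε ^ 2 := by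
          rw [hR, Real.mul_rpow hx0.le hs0.le, Real.rpow_sub hs0, hsα]
          have : s ^ (2 : ℝ) = s ^ 2 := by exact_mod_cast Real.rpow_natCast s 2
          rw [this]
          field_simp
        rw [← h6]
        gcongr
      exact ENNReal.toReal_le_of_le_ofReal (by positivity)
        (h.trans (ENNReal.ofReal_le_ofReal h5))
    have h7 := (measureReal_mono h2).trans (measureReal_union_le (μ := P) _ _)
    have h8 := hconc (m / s)
    linarith
  -- For `n = ⌈(r / x) ^ α⌉₊`, rounding up adds at most `1 ≤ r ^ α`, hence the `+ 1`.
  refine ⟨ε / 2 / (x ^ (-α) + 1), by positivity, fun r hr ↦ ?_⟩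
  have hr0 : 0 < r := by linarith
  set n := ⌈(r / x) ^ α⌉₊ with hn
  have hy0 : 0 < (r / x) ^ α := by positivity
  have hn0 : 0 < n := Nat.ceil_pos.2 hy0
  have hn' : (0 : ℝ) < n := by exact_mod_cast hn0
  have h1 : r ≤ x * (n : ℝ) ^ (1 / α) := by
    have := Real.rpow_le_rpow hy0.le (Nat.le_ceil ((r / x) ^ α)) (one_div_nonneg.2 hα.le)
    rw [← Real.rpow_mul (by positivity), mul_one_div_cancel hα.ne', Real.rpow_one,
      div_le_iff₀ hx0] at this
    linarith
  have h2 : (n : ℝ) ≤ r ^ α * (x ^ (-α) + 1) := by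
    have h3 := (Nat.ceil_lt_add_one hy0.le).le
    rw [Real.div_rpow hr0.le hx0.le, div_eq_mul_inv, ← Real.rpow_neg hx0.le] at h3
    have h4 : 1 ≤ r ^ α := Real.one_le_rpow hr hα.le
    have h5 : (n : ℝ) ≤ r ^ α * x ^ (-α) + 1 := by
      rw [hn, Real.div_rpow hr0.le hx0.le, div_eq_mul_inv, ← Real.rpow_neg hx0.le]
      exact h3
    linarith
  have h6 : P.real {ω | x * (n : ℝ) ^ (1 / α) < |Y ω|} ≤ P.real {ω | r < |Y ω|} :=
    measureReal_mono fun ω hω ↦ lt_of_le_of_lt h1 hω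
  have h7 := (key n hn0).trans (mul_le_mul_of_nonneg_left h6 hn'.le)
  have h8 := h7.trans (mul_le_mul_of_nonneg_right h2 measureReal_nonneg)
  rw [Real.rpow_neg hr0.le, div_mul_eq_mul_div, div_le_iff₀ (by positivity), ← div_eq_mul_inv,
    div_le_iff₀ (by positivity)]
  linarith

/-! ### Convergent case: strong law along dyadic blocks. -/

/-- Kronecker's lemma for nonnegative terms. -/
theorem tendsto_sum_mul_div_zero {A u : ℕ → ℝ} (hApos : ∀ m, 0 < A m) (hAm : Monotone A)
    (hA : Tendsto A atTop atTop) (hu : ∀ i, 0 ≤ u i) (hs : Summable u) :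
    Tendsto (fun m ↦ (∑ i ∈ Finset.range m, A (i + 1) * u i) / A m) atTop (𝓝 0) := by
  -- Each fixed term tends to zero as `A m → ∞`, and `A (i + 1) ≤ A m` for `i < m` makes `u` a
  -- dominating series.
  have h := tendsto_tsum_of_dominated_convergence (𝓕 := atTop)
    (f := fun m i ↦ if i < m then A (i + 1) * u i / A m else 0) (g := fun _ : ℕ ↦ (0 : ℝ)) hs
    (fun i ↦ by
      have h1 : Tendsto (fun m ↦ A (i + 1) * u i / A m) atTop (𝓝 0) :=
        Tendsto.div_atTop tendsto_const_nhds hA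
      refine h1.congr' ?_
      filter_upwards [eventually_gt_atTop i] with m hm
      rw [if_pos hm])
    (Eventually.of_forall fun m i ↦ by
      have hum := hu i
      split_ifs with him
      · rw [Real.norm_eq_abs, abs_of_nonneg
          (div_nonneg (mul_nonneg (hApos _).le (hu i)) (hApos m).le), div_le_iff₀ (hApos m),
          mul_comm]
        exact mul_le_mul_of_nonneg_left (hAm him) (hu i)
      · simpa using hu i)
  rw [tsum_zero] at h
  refine h.congr fun m ↦ ?_
  rw [tsum_eq_sum (s := Finset.range m) fun i hi ↦ if_neg (by simpa using hi), Finset.sum_div]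
  exact Finset.sum_congr rfl fun i hi ↦ if_pos (Finset.mem_range.1 hi)

/-- The sum of the squared normalized deviations has finite expectation, so it is finite almost
surely and its terms vanish. No independence between different `m` is required, which suits nested
partial sums. -/
theorem ae_tendsto_zero_of_summable_variance {Ω : Type*} [MeasurableSpace Ω] {P : Measure Ω}
    [IsProbabilityMeasure P] {T : ℕ → Ω → ℝ} (hT : ∀ m, MemLp (T m) 2 P) {B : ℕ → ℝ}
    (hs : Summable fun m ↦ variance (T m) P / B m ^ 2) :
    ∀ᵐ ω ∂P, Tendsto (fun m ↦ (T m ω - ∫ ω, T m ω ∂P) / B m) atTop (𝓝 0) := by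
  set F : ℕ → Ω → ℝ := fun m ω ↦ (T m ω - ∫ ω, T m ω ∂P) / B m with hF
  have hFL : ∀ m, MemLp (F m) 2 P := fun m ↦ by
    have := ((hT m).sub (memLp_const (∫ ω, T m ω ∂P))).mul_const (B m)⁻¹
    simpa [hF, div_eq_mul_inv] using this
  have hint : ∀ m, ∫⁻ ω, ENNReal.ofReal (F m ω ^ 2) ∂P =
      ENNReal.ofReal (variance (T m) P / B m ^ 2) := fun m ↦ by
    rw [← ofReal_integral_eq_lintegral_ofReal (hFL m).integrable_sq
      (Eventually.of_forall fun ω ↦ sq_nonneg _), variance_eq_integral (hT m).aemeasurable]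
    simp_rw [hF, div_pow, integral_div]
  have haem : ∀ m, AEMeasurable (fun ω ↦ ENNReal.ofReal (F m ω ^ 2)) P := fun m ↦
    ((hFL m).aemeasurable.pow_const 2).ennreal_ofReal
  have hfin : ∫⁻ ω, ∑' m, ENNReal.ofReal (F m ω ^ 2) ∂P ≠ ⊤ := by
    rw [lintegral_tsum haem]
    simp_rw [hint]
    exact hs.tsum_ofReal_ne_top
  filter_upwards [ae_lt_top' (AEMeasurable.tsum haem) hfin] with ω hω
  have h1 := ENNReal.tendsto_atTop_zero_of_tsum_ne_top hω.ne
  have h2 := (ENNReal.tendsto_toReal ENNReal.zero_ne_top).comp h1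
  have h3 : Tendsto (fun m ↦ √(F m ω ^ 2)) atTop (𝓝 0) := by
    have := (Real.continuous_sqrt.tendsto 0).comp h2
    simpa [Function.comp_def, ENNReal.toReal_ofReal (sq_nonneg _)] using this
  simp_rw [Real.sqrt_sq_eq_abs] at h3
  exact (tendsto_zero_iff_abs_tendsto_zero _).2 h3

/-- Pointwise form of a bound on truncated means by the tails at the levels `B i`. In the induction,
either `v ≤ B m` and raising the level changes nothing, or the new term alone dominates. -/
theorem truncate_le_sum_indicator {B : ℕ → ℝ} (hB0 : ∀ m, 0 ≤ B m) {v : ℝ} (hv : 0 ≤ v) (m : ℕ) :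
    truncate (B m) v ≤
      B 0 + ∑ i ∈ Finset.range m, B (i + 1) * Set.indicator {x | B i < x} (fun _ ↦ (1 : ℝ)) v := by
  have hnn : ∀ i, 0 ≤ B (i + 1) * Set.indicator {x | B i < x} (fun _ ↦ (1 : ℝ)) v := fun i ↦
    mul_nonneg (hB0 _) (Set.indicator_nonneg (fun _ _ ↦ zero_le_one) _)
  induction m with
  | zero =>
    simpa using (le_abs_self _).trans (abs_truncate_le (hB0 0) v)
  | succ m ih =>
    rw [Finset.sum_range_succ]
    by_cases h : v ≤ B m
    · have h1 : truncate (B m) v = v := if_pos (by rwa [abs_of_nonneg hv])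
      have h2 := (le_abs_self _).trans (abs_truncate_le_abs (B (m + 1)) v)
      rw [abs_of_nonneg hv] at h2
      linarith [hnn m]
    · rw [Set.indicator_of_mem (show v ∈ {x | B m < x} from not_le.1 h), mul_one]
      have h2 := (le_abs_self _).trans (abs_truncate_le (hB0 (m + 1)) v)
      linarith [hB0 0, Finset.sum_nonneg fun i (_ : i ∈ Finset.range m) ↦ hnn i]

theorem integral_truncate_le_sum {Ω : Type*} [MeasurableSpace Ω] {P : Measure Ω}
    [IsProbabilityMeasure P] {V : Ω → ℝ} (hV : Measurable V) (hV0 : ∀ ω, 0 ≤ V ω) {B : ℕ → ℝ}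
    (hB0 : ∀ m, 0 ≤ B m) (m : ℕ) :
    ∫ ω, truncate (B m) (V ω) ∂P ≤
      B 0 + ∑ i ∈ Finset.range m, B (i + 1) * P.real {ω | B i < |V ω|} := by
  have hms : ∀ i, MeasurableSet {ω | B i < V ω} := fun i ↦ measurableSet_lt measurable_const hV
  have hI : ∀ i, Integrable (fun ω ↦ B (i + 1) *
      Set.indicator {ω | B i < V ω} (fun _ ↦ (1 : ℝ)) ω) P := fun i ↦
    ((integrable_const (1 : ℝ)).indicator (hms i)).const_mul _
  have hle : ∫ ω, truncate (B m) (V ω) ∂P ≤ ∫ ω, (B 0 + ∑ i ∈ Finset.range m, B (i + 1) *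
      Set.indicator {ω | B i < V ω} (fun _ ↦ (1 : ℝ)) ω) ∂P :=
    integral_mono ((memLp_truncate hV (hB0 m) 2).integrable one_le_two)
      ((integrable_const _).add (integrable_finsetSum _ fun i _ ↦ hI i))
      fun ω ↦ truncate_le_sum_indicator hB0 (hV0 ω) m
  refine hle.trans_eq ?_
  rw [integral_add (integrable_const _) (integrable_finsetSum _ fun i _ ↦ hI i),
    integral_finsetSum _ fun i _ ↦ hI i]
  congr 1
  · simp
  · refine Finset.sum_congr rfl fun i _ ↦ ?_
    rw [integral_const_mul, integral_indicator_const _ (hms i)]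
    simp [abs_of_nonneg (hV0 _)]

/-- For bounded `A` the terms stay above a positive constant, because `2 ^ (m * (1 - β)) ≥ 1`. This
is where `β ≤ 1`, that is `α ≤ q`, is essential. -/
theorem tendsto_atTop_of_summable_condensed {A : ℕ → ℝ} (hApos : ∀ m, 0 < A m) (hAm : Monotone A)
    {β : ℝ} (hβ0 : 0 ≤ β) (hβ1 : β ≤ 1)
    (hs : Summable fun m : ℕ ↦ (2 : ℝ) ^ m * ((2 : ℝ) ^ m * A m) ^ (-β)) :
    Tendsto A atTop atTop := by
  rcases tendsto_atTop_of_monotone hAm with h | ⟨l, hl⟩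
  · exact h
  exfalso
  have hAl : ∀ m, A m ≤ l := hAm.ge_of_tendsto hl
  have hl0 : 0 < l := (hApos 0).trans_le (hAl 0)
  have hge : ∀ m : ℕ, l ^ (-β) ≤ (2 : ℝ) ^ m * ((2 : ℝ) ^ m * A m) ^ (-β) := fun m ↦ by
    have h2 : (1 : ℝ) ≤ 2 ^ m := one_le_pow₀ one_le_two
    rw [Real.mul_rpow (by positivity) (hApos m).le, ← mul_assoc]
    have h3 : (1 : ℝ) ≤ 2 ^ m * ((2 : ℝ) ^ m) ^ (-β) := by
      rw [mul_comm, ← Real.rpow_add_one (by positivity)]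
      exact Real.one_le_rpow h2 (by linarith)
    have h4 : l ^ (-β) ≤ A m ^ (-β) := Real.rpow_le_rpow_of_nonpos (hApos m) (hAl m) (by linarith)
    have h5 : 0 < l ^ (-β) := by positivity
    nlinarith
  have := ge_of_tendsto' hs.tendsto_atTop_zero hge
  have h5 : 0 < l ^ (-β) := by positivity
  linarith

/-- Strong law with a regular normalization: heavy-tailed nonnegative i.i.d. sums are negligible
with respect to `k * A k` as soon as the tails at `k * A k` are summable. -/
theorem ae_tendsto_sum_div_of_summable {Ω : Type*} [MeasurableSpace Ω] {P : Measure Ω}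
    [IsProbabilityMeasure P] {W : ℕ → Ω → ℝ} {V : Ω → ℝ} (hWm : ∀ i, Measurable (W i))
    (hVm : Measurable V) (hW : iIndepFun W P) (hid : ∀ i, IdentDistrib (W i) V P P)
    (hW0 : ∀ i ω, 0 ≤ W i ω) (hV0 : ∀ ω, 0 ≤ V ω) {C β : ℝ} (hC : 0 ≤ C) (hβ0 : 0 < β)
    (hβ1 : β ≤ 1) (htail : ∀ x : ℝ, 0 < x → P.real {ω | x < |V ω|} ≤ C * x ^ (-β))
    {A : ℕ → ℝ} (hA0 : ∀ k, 1 ≤ k → 0 < A k) (hA : ∀ k, 1 ≤ k → A k ≤ A (k + 1))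
    (hs : Summable fun k : ℕ ↦ (((k + 1 : ℕ) : ℝ) * A (k + 1)) ^ (-β)) (ℓ : ℕ) :
    ∀ᵐ ω ∂P, Tendsto (fun k : ℕ ↦ (∑ n ∈ Finset.range (k * ℓ), W n ω) / (k * A k)) atTop (𝓝 0) := by
  have hAmono : ∀ i j, 1 ≤ i → i ≤ j → A i ≤ A j := fun i j hi hij ↦ by
    induction j, hij using Nat.le_induction with
    | base => exact le_rfl
    | succ j hj ih => exact ih.trans (hA j (hi.trans hj))
  set D : ℕ → ℝ := fun m ↦ A (2 ^ m) with hD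
  have hD0 : ∀ m, 0 < D m := fun m ↦ hA0 _ Nat.one_le_two_pow
  have hDm : Monotone D := fun i j hij ↦
    hAmono _ _ Nat.one_le_two_pow (Nat.pow_le_pow_right two_pos hij)
  set B : ℕ → ℝ := fun m ↦ 2 ^ m * D m with hB
  have hB0 : ∀ m, 0 < B m := fun m ↦ mul_pos (by positivity) (hD0 m)
  have hcond : Summable fun m : ℕ ↦ (2 : ℝ) ^ m * B m ^ (-β) := by
    have hs' : Summable fun n : ℕ ↦ ((n : ℝ) * A n) ^ (-β) :=
      (summable_nat_add_iff (f := fun n : ℕ ↦ ((n : ℝ) * A n) ^ (-β)) 1).1 hs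
    have h := (summable_condensed_iff_of_nonneg (f := fun n : ℕ ↦ ((n : ℝ) * A n) ^ (-β)) ?_ ?_).2
      hs'
    · simpa [hB, hD] using h
    · intro n
      -- The extra term at zero is harmless, since `0 ^ (-β) = 0` by convention.
      rcases n.eq_zero_or_pos with rfl | hn
      · simp [Real.zero_rpow (neg_ne_zero.2 hβ0.ne')]
      · exact Real.rpow_nonneg (mul_nonneg (Nat.cast_nonneg _) (hA0 n hn).le) _
    · intro m n hm hmn
      have h1 : (0 : ℝ) < m := by exact_mod_cast hm
      exact Real.rpow_le_rpow_of_nonpos (mul_pos h1 (hA0 m hm))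
        (mul_le_mul (by exact_mod_cast hmn) (hAmono m n hm hmn) (hA0 m hm).le (by positivity))
        (by linarith)
  have hDtop : Tendsto D atTop atTop :=
    tendsto_atTop_of_summable_condensed hD0 hDm hβ0.le hβ1 hcond
  -- Length `2 ^ (m + 1) * ℓ` covers every sample `k * ℓ` with `2 ^ m ≤ k < 2 ^ (m + 1)`.
  set N : ℕ → ℕ := fun m ↦ 2 ^ (m + 1) * ℓ with hN
  have hNr : ∀ m, (N m : ℝ) = 2 * ℓ * 2 ^ m := fun m ↦ by
    simp only [hN, Nat.cast_mul, Nat.cast_pow, Nat.cast_ofNat, pow_succ]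
    ring
  set T : ℕ → Ω → ℝ := fun m ω ↦ ∑ i ∈ Finset.range (N m), truncate (B m) (W i ω) with hT
  have hmax : ∀ᵐ ω ∂P, ∀ᶠ m in atTop, ω ∉ ⋃ i ∈ Finset.range (N m), {ω | B m < |W i ω|} := by
    refine ae_eventually_notMem ?_
    have hle : ∀ m, P (⋃ i ∈ Finset.range (N m), {ω | B m < |W i ω|}) ≤
        ENNReal.ofReal (2 * ℓ * C * (2 ^ m * B m ^ (-β))) := fun m ↦ by
      rw [← ofReal_measureReal (measure_ne_top _ _)]
      refine ENNReal.ofReal_le_ofReal ((measureReal_biUnion_finset_le _ _).trans ?_)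
      have h1 : ∀ i ∈ Finset.range (N m), P.real {ω | B m < |W i ω|} ≤ C * B m ^ (-β) := by
        intro i _
        refine le_of_eq_of_le ?_ (htail _ (hB0 m))
        have h := (hid i).measure_mem_eq (s := {y | B m < |y|})
          (measurableSet_lt measurable_const measurable_id.abs)
        simp only [Measure.real]
        exact congrArg _ h
      refine (Finset.sum_le_card_nsmul _ _ _ h1).trans_eq ?_
      rw [Finset.card_range, nsmul_eq_mul, hNr]
      ring
    exact ne_top_of_le_ne_top (hcond.mul_left _).tsum_ofReal_ne_top (ENNReal.tsum_le_tsum hle)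
  have hTL : ∀ m, MemLp (T m) 2 P := fun m ↦
    memLp_finsetSum _ fun i _ ↦ memLp_truncate (hWm i) (hB0 m).le 2
  have hvar : ∀ᵐ ω ∂P, Tendsto (fun m ↦ (T m ω - ∫ ω, T m ω ∂P) / B m) atTop (𝓝 0) := by
    refine ae_tendsto_zero_of_summable_variance hTL ?_
    refine Summable.of_nonneg_of_le (fun m ↦ div_nonneg (variance_nonneg _ _) (sq_nonneg _))
      (fun m ↦ ?_) (hcond.mul_left (2 * ℓ * (2 * C / (2 - β))))
    rw [div_le_iff₀ (pow_pos (hB0 m) 2)]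
    refine (variance_sum_truncate_le hWm hVm hW hid hC (by linarith) htail (hB0 m) _).trans_eq ?_
    rw [hNr, sub_eq_add_neg 2 β, Real.rpow_add (hB0 m)]
    have : B m ^ (2 : ℝ) = B m ^ 2 := by exact_mod_cast Real.rpow_natCast (B m) 2
    rw [this]
    ring
  -- After division by `B m` the mean is `2 * ℓ` times a truncated mean over `D m`. The tail terms
  -- have the form `D (i + 1) * u i` with `u` summable, as Kronecker's lemma requires.
  have hmean : Tendsto (fun m ↦ (∫ ω, T m ω ∂P) / B m) atTop (𝓝 0) := by
    have hu : ∀ i : ℕ, 0 ≤ 2 * C * (2 ^ i * B i ^ (-β)) := fun i ↦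
      mul_nonneg (by positivity) (mul_nonneg (by positivity) (Real.rpow_nonneg (hB0 i).le _))
    have hk := tendsto_sum_mul_div_zero hD0 hDm hDtop hu (hcond.mul_left (2 * C))
    have hk' := ((tendsto_const_nhds (x := B 0)).div_atTop hDtop).add hk
    have hlim := hk'.const_mul (2 * (ℓ : ℝ))
    simp only [add_zero, mul_zero] at hlim
    have hET : ∀ m, ∫ ω, T m ω ∂P = N m * ∫ ω, truncate (B m) (V ω) ∂P := fun m ↦ by
      rw [hT, integral_finsetSum _ fun i _ ↦
        (memLp_truncate (hWm i) (hB0 m).le 2).integrable one_le_two]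
      refine (Finset.sum_congr rfl fun i _ ↦
        ((hid i).comp (measurable_truncate (B m))).integral_eq).trans ?_
      simp
    have htr0 : ∀ m ω, 0 ≤ truncate (B m) (V ω) := fun m ω ↦ by
      unfold truncate
      split_ifs
      · exact hV0 ω
      · exact le_rfl
    refine squeeze_zero (fun m ↦ ?_) (fun m ↦ ?_) hlim
    · rw [hET]
      exact div_nonneg (mul_nonneg (Nat.cast_nonneg _) (integral_nonneg (htr0 m))) (hB0 m).le
    · have h1 := integral_truncate_le_sum (P := P) hVm hV0 (fun m ↦ (hB0 m).le) m
      have h2 : ∑ i ∈ Finset.range m, B (i + 1) * P.real {ω | B i < |V ω|} ≤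
          ∑ i ∈ Finset.range m, D (i + 1) * (2 * C * (2 ^ i * B i ^ (-β))) := by
        refine Finset.sum_le_sum fun i _ ↦ ?_
        refine (mul_le_mul_of_nonneg_left (htail _ (hB0 i)) (hB0 _).le).trans_eq ?_
        simp only [hB, pow_succ]
        ring
      have h3 : (∫ ω, T m ω ∂P) / B m = 2 * ℓ * ((∫ ω, truncate (B m) (V ω) ∂P) / D m) := by
        rw [hET, hNr]
        have := (hD0 m).ne'
        simp only [hB]
        field_simp
      rw [h3, ← add_div]
      have := hD0 m
      gcongr
      linarith
  filter_upwards [hmax, hvar] with ω h1 h2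
  have hT0 : Tendsto (fun m ↦ T m ω / B m) atTop (𝓝 0) := by
    have := h2.add hmean
    rw [add_zero] at this
    refine this.congr fun m ↦ ?_
    rw [← add_div, sub_add_cancel]
  have hS : Tendsto (fun m ↦ (∑ n ∈ Finset.range (N m), W n ω) / B m) atTop (𝓝 0) := by
    refine hT0.congr' (h1.mono fun m hm ↦ ?_)
    simp only [Set.mem_iUnion, Set.mem_ofPred_eq, not_exists, not_lt] at hm
    rw [hT]
    congr 1
    exact Finset.sum_congr rfl fun i hi ↦ if_pos (hm i hi)
  have hlog : Tendsto (fun k ↦ Nat.log 2 k) atTop atTop :=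
    tendsto_atTop_atTop.2 fun b ↦ ⟨2 ^ b, fun k hk ↦ Nat.le_log_of_pow_le one_lt_two hk⟩
  -- Numerator and denominator are both monotone in `k`, so the ratio at `k` is at most the one for
  -- the block `m = Nat.log 2 k`.
  refine squeeze_zero' ?_ ?_ (hS.comp hlog)
  · filter_upwards [eventually_ge_atTop 1] with k hk
    exact div_nonneg (Finset.sum_nonneg fun i _ ↦ hW0 i ω)
      (mul_nonneg (Nat.cast_nonneg _) (hA0 k hk).le)
  · filter_upwards [eventually_ge_atTop 1] with k hk
    have hle : 2 ^ Nat.log 2 k ≤ k := Nat.pow_log_le_self 2 (by omega)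
    have hlt : k < 2 ^ (Nat.log 2 k + 1) := Nat.lt_pow_succ_log_self one_lt_two k
    have h3 : B (Nat.log 2 k) ≤ k * A k :=
      mul_le_mul (by exact_mod_cast hle) (hAmono _ _ Nat.one_le_two_pow hle) (hD0 _).le
        (by positivity)
    exact div_le_div₀ (Finset.sum_nonneg fun i _ ↦ hW0 i ω)
      (Finset.sum_le_sum_of_subset_of_nonneg
        (Finset.range_mono (Nat.mul_le_mul_right _ hlt.le)) fun i _ _ ↦ hW0 i ω) (hB0 _) h3

/-! ### Divergent case: second Borel–Cantelli lemma. -/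

/-- The last summand of the `k`-th sample, of index `k * ℓ - 1`, already suffices: different `k`
give different indices, hence independent events, whose probabilities have a divergent sum. -/
theorem ae_frequently_lt_sum_div_of_not_summable {Ω : Type*} [MeasurableSpace Ω] {P : Measure Ω}
    [IsProbabilityMeasure P] {W : ℕ → Ω → ℝ} {V : Ω → ℝ} (hWm : ∀ i, Measurable (W i))
    (hW : iIndepFun W P) (hid : ∀ i, IdentDistrib (W i) V P P)
    (hW0 : ∀ i ω, 0 ≤ W i ω) {c y₀ β : ℝ} (hc : 0 < c)
    (htail : ∀ x : ℝ, y₀ ≤ x → c * x ^ (-β) ≤ P.real {ω | x < |V ω|})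
    {A : ℕ → ℝ} (hA0 : ∀ k, 1 ≤ k → 0 < A k) (hA : ∀ k, 1 ≤ k → A k ≤ A (k + 1))
    (hs : ¬ Summable fun k : ℕ ↦ (((k + 1 : ℕ) : ℝ) * A (k + 1)) ^ (-β)) {ℓ : ℕ} (hℓ : 0 < ℓ)
    {M : ℝ} (hM : 0 < M) :
    ∀ᵐ ω ∂P, ∃ᶠ k : ℕ in atTop, M < (∑ n ∈ Finset.range (k * ℓ), W n ω) / (k * A k) := by
  have hA1 : ∀ j, 1 ≤ j → A 1 ≤ A j := fun j hj ↦ by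
    induction j, hj using Nat.le_induction with
    | base => exact le_rfl
    | succ j hj ih => exact ih.trans (hA j hj)
  set b : ℕ → ℝ := fun k ↦ ((k + 1 : ℕ) : ℝ) * A (k + 1) with hb
  have hb0 : ∀ k, 0 < b k := fun k ↦ mul_pos (by positivity) (hA0 _ (by omega))
  -- The lower tail bound holds only beyond `y₀`, so the thresholds must eventually pass it.
  have hbtop : Tendsto (fun k ↦ M * b k) atTop atTop := by
    refine Tendsto.const_mul_atTop hM ?_
    have h1 : Tendsto (fun k : ℕ ↦ ((k + 1 : ℕ) : ℝ) * A 1) atTop atTop :=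
      (tendsto_natCast_atTop_atTop.comp (tendsto_add_atTop_nat 1)).atTop_mul_const
        (hA0 1 le_rfl)
    exact tendsto_atTop_mono (fun k ↦
      mul_le_mul_of_nonneg_left (hA1 (k + 1) (by omega)) (Nat.cast_nonneg _)) h1
  have hidx : ∀ k, (k + 1) * ℓ - 1 + 1 = (k + 1) * ℓ := fun k ↦
    Nat.sub_add_cancel (Nat.mul_pos (Nat.succ_pos k) hℓ)
  have hinj : Function.Injective fun k ↦ (k + 1) * ℓ - 1 := fun i j hij ↦ by
    have h1 : (i + 1) * ℓ = (j + 1) * ℓ := by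
      rw [← hidx i, ← hidx j]
      exact congrArg (· + 1) hij
    have := Nat.eq_of_mul_eq_mul_right hℓ h1
    omega
  set s : ℕ → Set Ω := fun k ↦ W ((k + 1) * ℓ - 1) ⁻¹' {y | M * b k < |y|} with hs_def
  have hset : ∀ k, MeasurableSet {y : ℝ | M * b k < |y|} := fun k ↦
    measurableSet_lt measurable_const measurable_id.abs
  have hsm : ∀ k, MeasurableSet (s k) := fun k ↦ hWm _ (hset k)
  have hindep : iIndepSet s P := by
    rw [iIndepSet_iff_meas_biInter hsm]
    intro S
    exact (hW.precomp hinj).measure_inter_preimage_eq_mul S fun i _ ↦ hset i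
  have hPs : ∀ k, P.real (s k) = P.real {ω | M * b k < |V ω|} := fun k ↦ by
    simp only [Measure.real]
    exact congrArg _ ((hid _).measure_mem_eq (hset k))
  have htop : ∑' k, P (s k) = ⊤ := by
    by_contra hne
    have hsum : Summable fun k ↦ P.real (s k) := ENNReal.summable_toReal hne
    refine hs ?_
    have h1 : Summable fun k ↦ (c * M ^ (-β))⁻¹ * P.real (s k) := hsum.mul_left _
    refine h1.of_norm_bounded_eventually_nat ?_
    filter_upwards [hbtop.eventually_ge_atTop y₀] with k hk
    have h2 := htail _ hk
    rw [← hPs, Real.mul_rpow hM.le (hb0 k).le, ← mul_assoc] at h2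
    have h3 : 0 < c * M ^ (-β) := by positivity
    rw [Real.norm_eq_abs, abs_of_nonneg (Real.rpow_nonneg (hb0 k).le _), inv_mul_eq_div,
      le_div_iff₀ h3]
    linarith
  have hone := measure_limsup_eq_one hsm hindep htop
  have hae : ∀ᵐ ω ∂P, ω ∈ limsup s atTop :=
    (mem_ae_iff_prob_eq_one (MeasurableSet.measurableSet_limsup hsm)).2 hone
  filter_upwards [hae] with ω hω
  rw [mem_limsup_iff_frequently_mem] at hω
  refine (tendsto_add_atTop_nat 1).frequently (hω.mono fun k hk ↦ ?_)
  have hk : M * b k < |W ((k + 1) * ℓ - 1) ω| := hk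
  rw [abs_of_nonneg (hW0 _ _)] at hk
  rw [lt_div_iff₀ (hb0 k)]
  refine hk.trans_le (Finset.single_le_sum (f := fun n ↦ W n ω) (fun i _ ↦ hW0 i ω) ?_)
  have := hidx k
  exact Finset.mem_range.2 (by omega)

/-! ### Application to the empirical moments of the process. -/

theorem IsSelfSimilarLevyProcess.identDistrib_increment {Ω : Type*} [MeasurableSpace Ω]
    {P : Measure Ω} {X : ℝ≥0 → Ω → ℝ} {α : ℝ} (hX : IsSelfSimilarLevyProcess X α P) (t : ℝ≥0)
    {s : ℝ≥0} (hs : 0 < s) :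
    IdentDistrib (increment X t s) (fun ω ↦ (s : ℝ) ^ (1 / α) * X 1 ω) P P := by
  have h1 : IdentDistrib (increment X 0 s) (X s) P P := by
    refine IdentDistrib.of_ae_eq ?_ ?_
    · exact ((hX.levy.measurable _).sub (hX.levy.measurable _)).aemeasurable
    · filter_upwards [hX.levy.zero] with ω hω
      simp [increment, hω]
  have h2 := hX.selfSimilar.2 s 1 hs one_pos
  rw [mul_one] at h2
  exact ((hX.levy.stationary t s).trans h1).trans h2

theorem IsSelfSimilarLevyProcess.iIndepFun_increment {Ω : Type*} [MeasurableSpace Ω]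
    {P : Measure Ω} {X : ℝ≥0 → Ω → ℝ} {α : ℝ} (hX : IsSelfSimilarLevyProcess X α P) (τ : ℕ) :
    iIndepFun (fun n : ℕ ↦ increment X ((τ * n : ℕ) : ℝ≥0) (τ : ℝ≥0)) P := by
  have h := hX.levy.indep.nat (t := fun n : ℕ ↦ ((τ * n : ℕ) : ℝ≥0)) fun i j hij ↦
    Nat.cast_le.2 (Nat.mul_le_mul_left τ hij)
  convert h using 3 with n ω
  simp [increment, mul_add]

/-- The marginal at time one has tails of exact order `x ^ (-α)`. -/
theorem IsSelfSimilarLevyProcess.exists_tail_bounds {Ω : Type*} [MeasurableSpace Ω]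
    {P : Measure Ω} [IsProbabilityMeasure P] {X : ℝ≥0 → Ω → ℝ} {α : ℝ} (hα0 : 0 < α)
    (hα2 : α < 2) (hX : IsSelfSimilarLevyProcess X α P) :
    (∃ C : ℝ, 0 < C ∧ ∀ x : ℝ, 0 < x → P.real {ω | x < |X 1 ω|} ≤ C * x ^ (-α)) ∧
      ∃ c : ℝ, 0 < c ∧ ∀ x : ℝ, 1 ≤ x → c * x ^ (-α) ≤ P.real {ω | x < |X 1 ω|} := by
  set Z : ℕ → Ω → ℝ := fun n ↦ increment X ((1 * n : ℕ) : ℝ≥0) ((1 : ℕ) : ℝ≥0) with hZ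
  have hZm : ∀ i, Measurable (Z i) := fun i ↦ (hX.levy.measurable _).sub (hX.levy.measurable _)
  have hZi : iIndepFun Z P := hX.iIndepFun_increment 1
  have hid : ∀ i, IdentDistrib (Z i) (X 1) P P := fun i ↦ by
    simpa [hZ] using hX.identDistrib_increment ((1 * i : ℕ) : ℝ≥0) (s := ((1 : ℕ) : ℝ≥0)) (by simp)
  -- Unit increments telescope to `X_n - X_k`, so the stability of block sums is exactly
  -- self-similarity.
  have hsum : ∀ k n, k < n → IdentDistrib (fun ω ↦ ∑ i ∈ Finset.Ico k n, Z i ω)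
      (fun ω ↦ ((n - k : ℕ) : ℝ) ^ (1 / α) * X 1 ω) P P := by
    intro k n hkn
    have h := hX.identDistrib_increment (k : ℝ≥0) (s := ((n - k : ℕ) : ℝ≥0))
      (by exact_mod_cast Nat.sub_pos_of_lt hkn)
    convert h using 1
    · ext ω
      have h1 := Finset.sum_Ico_sub (fun i : ℕ ↦ X (i : ℝ≥0) ω) hkn.le
      have h2 : (k : ℝ≥0) + ((n - k : ℕ) : ℝ≥0) = n := by
        rw [← Nat.cast_add, Nat.add_sub_cancel' hkn.le]
      simp only [increment, h2]
      simpa [hZ, increment] using h1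
    · simp only [NNReal.coe_natCast]
  obtain ⟨C, hC, htail⟩ :=
    exists_tail_le_of_stable hα0 hZm (hX.levy.measurable 1) hZi hid hsum
  refine ⟨⟨C, hC, htail⟩, ?_⟩
  refine exists_le_tail_of_stable hα0 hα2 hZm (hX.levy.measurable 1) hZi hid (fun n hn ↦ ?_) hC
    htail hX.nondegenerate
  simpa only [Finset.range_eq_Ico, Nat.sub_zero] using hsum 0 n hn

theorem measureReal_rpow_abs_mul {Ω : Type*} [MeasurableSpace Ω] {P : Measure Ω} {Y : Ω → ℝ}
    {σ q y : ℝ} (hσ : 0 < σ) (hq : 0 < q) (hy : 0 < y) :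
    P.real {ω | y < |(|σ * Y ω| ^ q)|} = P.real {ω | y ^ (1 / q) / σ < |Y ω|} := by
  congr 1
  ext ω
  simp only [Set.mem_ofPred_eq]
  rw [abs_of_nonneg (Real.rpow_nonneg (abs_nonneg _) _), abs_mul, abs_of_pos hσ,
    div_lt_iff₀ hσ, mul_comm |Y ω|, one_div,
    Real.rpow_inv_lt_iff_of_pos hy.le (by positivity) hq]

theorem rpow_one_div_div_rpow_neg {σ q y α : ℝ} (hσ : 0 < σ) (hy : 0 < y) :
    (y ^ (1 / q) / σ) ^ (-α) = σ ^ α * y ^ (-(α / q)) := by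
  rw [Real.div_rpow (by positivity) hσ.le, ← Real.rpow_mul hy.le, Real.rpow_neg hσ.le,
    div_inv_eq_mul, mul_comm]
  congr 2
  ring

/-- Since `τ` divides the least common multiple, each unit of `k` contributes exactly `lcmUpTo T /
τ` windows. Up to this constant, the normalization becomes `k * a`. -/
theorem empiricalMoment_div_eq {Ω : Type*} (X : ℝ≥0 → Ω → ℝ) (q : ℝ) {τ T : ℕ} (hτ : τ ∣ lcmUpTo T)
    (a : ℝ) (k : ℕ) (ω : Ω) :
    empiricalMoment X q τ (sampleSize T k) ω / a =
      ((lcmUpTo T / τ : ℕ) : ℝ)⁻¹ * ((∑ n ∈ Finset.range (k * (lcmUpTo T / τ)),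
        |increment X ((τ * n : ℕ) : ℝ≥0) (τ : ℝ≥0) ω| ^ q) / (k * a)) := by
  have h : sampleSize T k / τ = k * (lcmUpTo T / τ) := Nat.mul_div_assoc _ hτ
  rw [empiricalMoment, h, Nat.cast_mul, div_eq_mul_inv, div_eq_mul_inv, div_eq_mul_inv, mul_inv,
    mul_inv]
  ring

theorem proposition1 {Ω : Type*} [MeasurableSpace Ω] (P : Measure Ω) [IsProbabilityMeasure P]
    (X : ℝ≥0 → Ω → ℝ) (α : ℝ) (hα0 : 0 < α) (hα2 : α < 2)
    (hX : IsSelfSimilarLevyProcess X α P)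
    (T : ℕ) (hT : 0 < T) (q : ℝ) (hq : α ≤ q)
    (a : ℕ → ℝ) (ha_pos : ∀ k : ℕ, 1 ≤ k → 0 < a (sampleSize T k))
    (ha_mono : ∀ k : ℕ, 1 ≤ k → a (sampleSize T k) ≤ a (sampleSize T (k + 1))) :
    (Summable (fun k : ℕ ↦ (((k + 1 : ℕ) : ℝ) * a (sampleSize T (k + 1))) ^ (-(α / q))) →
      ∀ᵐ ω ∂P, ∀ τ ∈ Finset.Icc 1 T,
        Tendsto (fun k : ℕ ↦ empiricalMoment X q τ (sampleSize T k) ω / a (sampleSize T k))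
          atTop (𝓝 0)) ∧
    (¬ Summable (fun k : ℕ ↦ (((k + 1 : ℕ) : ℝ) * a (sampleSize T (k + 1))) ^ (-(α / q))) →
      ∀ᵐ ω ∂P, ∀ τ ∈ Finset.Icc 1 T,
        limsup (fun k : ℕ ↦
          ((empiricalMoment X q τ (sampleSize T k) ω / a (sampleSize T k) : ℝ) : EReal))
          atTop = ⊤) := by
  have hq0 : 0 < q := hα0.trans_le hq
  obtain ⟨⟨C, hC, hup⟩, c, hc, hlow⟩ := hX.exists_tail_bounds hα0 hα2
  have hL : 0 < lcmUpTo T := Nat.pos_of_ne_zero fun h ↦ by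
    rw [lcmUpTo, Finset.lcm_eq_zero_iff] at h
    simp at h
  have hdvd : ∀ τ ∈ Finset.Icc 1 T, τ ∣ lcmUpTo T := fun τ hτ ↦ Finset.dvd_lcm (f := id) hτ
  have hτ0 : ∀ τ ∈ Finset.Icc 1 T, 0 < τ := fun τ hτ ↦ (Finset.mem_Icc.1 hτ).1
  have hℓ : ∀ τ ∈ Finset.Icc 1 T, 0 < lcmUpTo T / τ := fun τ hτ ↦
    Nat.div_pos (Nat.le_of_dvd hL (hdvd τ hτ)) (hτ0 τ hτ)
  have hpow : Measurable fun y : ℝ ↦ |y| ^ q := measurable_id.abs.pow_const q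
  have hm : ∀ s t, Measurable (increment X s t) := fun s t ↦
    (hX.levy.measurable _).sub (hX.levy.measurable _)
  have hWm : ∀ τ i : ℕ, Measurable fun ω ↦ |increment X ((τ * i : ℕ) : ℝ≥0) (τ : ℝ≥0) ω| ^ q :=
    fun τ i ↦ hpow.comp (hm _ _)
  have hWi : ∀ τ : ℕ, iIndepFun
      (fun (i : ℕ) ω ↦ |increment X ((τ * i : ℕ) : ℝ≥0) (τ : ℝ≥0) ω| ^ q) P := fun τ ↦
    (hX.iIndepFun_increment τ).comp (fun _ y ↦ |y| ^ q) fun _ ↦ hpow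
  have hW0 : ∀ (τ i : ℕ) (ω : Ω), 0 ≤ |increment X ((τ * i : ℕ) : ℝ≥0) (τ : ℝ≥0) ω| ^ q :=
    fun _ _ _ ↦ Real.rpow_nonneg (abs_nonneg _) _
  have hWid : ∀ τ ∈ Finset.Icc 1 T, ∀ i : ℕ,
      IdentDistrib (fun ω ↦ |increment X ((τ * i : ℕ) : ℝ≥0) (τ : ℝ≥0) ω| ^ q)
        (fun ω ↦ |(τ : ℝ) ^ (1 / α) * X 1 ω| ^ q) P P := fun τ hτ i ↦ by
    have h := hX.identDistrib_increment ((τ * i : ℕ) : ℝ≥0) (s := (τ : ℝ≥0))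
      (by exact_mod_cast hτ0 τ hτ)
    exact h.comp hpow
  have hσ : ∀ τ ∈ Finset.Icc 1 T, 0 < (τ : ℝ) ^ (1 / α) := fun τ hτ ↦
    Real.rpow_pos_of_pos (by exact_mod_cast hτ0 τ hτ) _
  refine ⟨fun hs ↦ ?_, fun hs ↦ ?_⟩
  · refine (eventually_all_finset _).2 fun τ hτ ↦ ?_
    have htail : ∀ x : ℝ, 0 < x → P.real {ω | x < |(|(τ : ℝ) ^ (1 / α) * X 1 ω| ^ q)|} ≤
        C * ((τ : ℝ) ^ (1 / α)) ^ α * x ^ (-(α / q)) := fun x hx ↦ by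
      have := hσ τ hτ
      rw [measureReal_rpow_abs_mul this hq0 hx, mul_assoc, ← rpow_one_div_div_rpow_neg this hx]
      exact hup _ (by positivity)
    have h := ae_tendsto_sum_div_of_summable (hWm τ)
      (hpow.comp ((hX.levy.measurable 1).const_mul _)) (hWi τ) (hWid τ hτ) (hW0 τ)
      (fun ω ↦ Real.rpow_nonneg (abs_nonneg _) _)
      (mul_nonneg hC.le (Real.rpow_nonneg (hσ τ hτ).le _)) (div_pos hα0 hq0)
      ((div_le_one hq0).2 hq) htail (A := fun k ↦ a (sampleSize T k)) ha_pos ha_mono hs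
      (lcmUpTo T / τ)
    filter_upwards [h] with ω hω
    simp_rw [empiricalMoment_div_eq X q (hdvd τ hτ)]
    simpa using hω.const_mul ((lcmUpTo T / τ : ℕ) : ℝ)⁻¹
  · refine (eventually_all_finset _).2 fun τ hτ ↦ ?_
    -- The threshold is the point where `x ^ (1/q) / τ ^ (1/α)` reaches one, from which the lower
    -- tail of `X 1` is available.
    have htail : ∀ x : ℝ, ((τ : ℝ) ^ (1 / α)) ^ q ≤ x →
        c * ((τ : ℝ) ^ (1 / α)) ^ α * x ^ (-(α / q)) ≤
          P.real {ω | x < |(|(τ : ℝ) ^ (1 / α) * X 1 ω| ^ q)|} := fun x hx ↦ by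
      have h0 := hσ τ hτ
      have hx0 : 0 < x := (Real.rpow_pos_of_pos h0 _).trans_le hx
      rw [measureReal_rpow_abs_mul h0 hq0 hx0, mul_assoc, ← rpow_one_div_div_rpow_neg h0 hx0]
      refine hlow _ ((one_le_div h0).2 ?_)
      rw [one_div q]
      exact (Real.le_rpow_inv_iff_of_pos h0.le hx0.le hq0).2 hx
    -- Integer levels keep the exceptional set null. The factor `lcmUpTo T / τ` offsets the one in
    -- `empiricalMoment_div_eq`, and `M + 1` keeps the level positive at `M = 0`.
    have h : ∀ᵐ ω ∂P, ∀ M : ℕ, _ := ae_all_iff.2 fun M : ℕ ↦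
      ae_frequently_lt_sum_div_of_not_summable (hWm τ) (hWi τ) (hWid τ hτ) (hW0 τ)
        (mul_pos hc (Real.rpow_pos_of_pos (hσ τ hτ) _)) htail (A := fun k ↦ a (sampleSize T k))
        ha_pos ha_mono hs (hℓ τ hτ) (M := ((lcmUpTo T / τ : ℕ) : ℝ) * (M + 1))
        (mul_pos (by exact_mod_cast hℓ τ hτ) (by positivity))
    filter_upwards [h] with ω hω
    rw [EReal.eq_top_iff_forall_lt]
    intro y
    obtain ⟨M, hM⟩ := exists_nat_gt y
    refine lt_of_lt_of_le (b := ((M : ℝ) : EReal)) (by exact_mod_cast hM) ?_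
    refine le_limsup_of_frequently_le ((hω M).mono fun k hk ↦ ?_)
    have hℓ' : (0 : ℝ) < ((lcmUpTo T / τ : ℕ) : ℝ) := by exact_mod_cast hℓ τ hτ
    rw [EReal.coe_le_coe_iff, empiricalMoment_div_eq X q (hdvd τ hτ), inv_mul_eq_div,
      le_div_iff₀ hℓ']
    nlinarith
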